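/- Let $X$ be a set and let $\mathcal H$ be a reproducing kernel Hilbert space of complex-valued functions on $X$ with reproducing kernel $k$. Let $$\mathrm{Mult}(\mathcal H)=\{\varphi:X\to\mathbb C:\ \varphi f\in\mathcal H\text{ for all }f\in\mathcal H\}$$ be its multiplier algebra; each $\varphi\in\mathrm{Mult}(\mathcal H)$ defines a bounded multiplication operator $M_\varphi$ on $\mathcal H$. Call $\psi\in\mathrm{Mult}(\mathcal H)$ cyclic if $M_\psi$ has dense range, and put $$N^+(\mathcal H)=\Big\{\frac{\varphi}{\psi}:\ \varphi,\psi\in\mathrm{Mult}(\mathcal H),\ \psi\text{ cyclic}\Big\}.$$ Assume that $\mathcal H$ is normalized, i.e. there is $x_0\in X$ with $k(x,x_0)=1$ for all $x\in X$ (cyclic multipliers then vanish nowhere, so these quotients are defined on all of $X$), and that $\mathcal H$ is a complete Pick space, i.e. for all $r,n\in\mathbb N$, $z_1,\dots,z_n\in X$ and $W_1,\dots,W_n\in M_r(\mathbb C)$, positive semidefiniteness of the block matrix $\big[k(z_i,z_j)(I-W_iW_j^*)\big]_{i,j=1}^n$ implies that there is $\Phi\in M_r(\mathrm{Mult}(\mathcal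 H))$, of norm at most $1$ as an operator on $\mathcal H^r$, with $\Phi(z_i)=W_i$ for $i=1,\dots,n$. For a class $S$ of functions on $X$, a subset $Z\subset X$ is called a zero set for $S$ if some function in $S$ vanishes exactly on $Z$. Then for every $Z\subset X$ the following are equivalent: $Z$ is a zero set for $\mathcal H$; $Z$ is a zero set for $\mathrm{Mult}(\mathcal H)$; $Z$ is a zero set for $N^+(\mathcal H)$. In particular, if $Z_1$ and $Z_2$ are zero sets for $\mathcal H$, then $Z_1\cup Z_2$ is a zero set for $\mathcal H$. -/

import Mathlib

noncomputable section

namespace CompletePick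

open scoped ComplexOrder

variable {X : Type*} (H : Type*) [NormedAddCommGroup H] [InnerProductSpace ℂ H] [RKHS ℂ H X ℂ]

/-- The multiplier algebra of a space `H` of functions on `X`: all `φ : X → ℂ` such that
`φ f ∈ H` for all `f ∈ H`. -/
def Mult : Subalgebra ℂ (X → ℂ) where
  carrier := {φ | ∀ f : H, ∃ g : H, ⇑g = φ * ⇑f}
  mul_mem' := by
    intro φ ψ hφ hψ f
    obtain ⟨g, hg⟩ := hψ f
    obtain ⟨h, hh⟩ := hφ g
    exact ⟨h, by rw [hh, hg, mul_assoc]⟩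
  add_mem' := by
    intro φ ψ hφ hψ f
    obtain ⟨g, hg⟩ := hφ f
    obtain ⟨h, hh⟩ := hψ f
    exact ⟨g + h, by rw [RKHS.coe_add, hg, hh, add_mul]⟩
  algebraMap_mem' := by
    intro c f
    exact ⟨c • f, by rw [RKHS.coe_smul, Algebra.algebraMap_eq_smul_one, smul_mul_assoc, one_mul]⟩

variable {H}

/-- The product `φ f` of a multiplier `φ` and `f ∈ H`, as an element of `H`. -/
def mulFun (φ : Mult H) (f : H) : H := Classical.choose (φ.2 f)

theorem mulFun_apply (φ : Mult H) (f : H) (x : X) : mulFun φ f x = (φ : X → ℂ) x * f x :=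
  congrFun (Classical.choose_spec (φ.2 f)) x

/-- The multiplication operator `f ↦ φ f` of a multiplier `φ`, as a linear map. -/
def mulLinear (φ : Mult H) : H →ₗ[ℂ] H where
  toFun := mulFun φ
  map_add' f g := by
    ext x
    simp [mulFun_apply, mul_add]
  map_smul' c f := by
    ext x
    simp [mulFun_apply, mul_left_comm]

theorem mulLinear_apply (φ : Mult H) (f : H) (x : X) :
    mulLinear φ f x = (φ : X → ℂ) x * f x :=
  mulFun_apply φ f x

variable [CompleteSpace H]

/-- The multiplication operator `M_φ` as a bounded operator on `H`; boundedness is the closed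
graph theorem. -/
def mulOp (φ : Mult H) : H →L[ℂ] H :=
  ContinuousLinearMap.ofSeqClosedGraph (g := mulLinear φ) (by
    intro u f g hu hg
    apply DFunLike.coe_injective
    funext x
    have h1 := ((RKHS.continuous_eval (𝕜 := ℂ) x).tendsto g).comp hg
    have h2 := (((RKHS.continuous_eval (𝕜 := ℂ) x).tendsto f).comp hu).const_mul
      ((φ : X → ℂ) x)
    rw [mulLinear_apply]
    refine tendsto_nhds_unique h1 (h2.congr fun n => ?_)
    exact (mulLinear_apply φ (u n) x).symm)

theorem mulOp_apply (φ : Mult H) (f : H) (x : X) :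
    mulOp φ f x = (φ : X → ℂ) x * f x :=
  mulLinear_apply φ f x

/-- The operator on the Hilbert space `H ⊕ ⋯ ⊕ H` (`r` summands) given by an `r × r` matrix of
multipliers. Its operator norm is the norm of the matrix in `M_r(Mult(H))`. -/
def matrixMulOp {r : ℕ} (Φ : Matrix (Fin r) (Fin r) (Mult H)) :
    PiLp 2 (fun _ : Fin r => H) →L[ℂ] PiLp 2 (fun _ : Fin r => H) :=
  ((PiLp.continuousLinearEquiv 2 ℂ (fun _ : Fin r => H)).symm :
      (Fin r → H) →L[ℂ] PiLp 2 (fun _ : Fin r => H)) ∘L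
    ContinuousLinearMap.pi fun i => ∑ j, mulOp (Φ i j) ∘L PiLp.proj 2 (fun _ : Fin r => H) j

theorem matrixMulOp_apply {r : ℕ} (Φ : Matrix (Fin r) (Fin r) (Mult H))
    (F : PiLp 2 (fun _ : Fin r => H)) (i : Fin r) :
    matrixMulOp Φ F i = ∑ j, mulOp (Φ i j) (F j) := by
  simp [matrixMulOp]

/-- A multiplier is cyclic if its multiplication operator has dense range. -/
def IsCyclic (ψ : Mult H) : Prop := DenseRange (mulOp ψ)

variable (H)

/-- The scalar reproducing kernel: `k(z, w) = k_w(z)` where `⟨f, k_w⟩ = f(w)` for all `f ∈ H`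
(inner product linear in the first entry). -/
def ker (z w : X) : ℂ := RKHS.kernel H z w 1

/-- The kernel of `H` is normalized at some point `x₀`: `k(x, x₀) = 1` for all `x`. -/
def IsNormalized : Prop := ∃ x₀ : X, ∀ x : X, ker H x x₀ = 1

/-- The complete Pick property: whenever the block matrix `[k(z_i, z_j) (I - W_i W_j^*)]` is
positive semidefinite, some `Φ` in the closed unit ball of `M_r(Mult(H))` has `Φ(z_i) = W_i`. -/
def IsCompletePick : Prop :=
  ∀ (r n : ℕ) (z : Fin n → X) (W : Fin n → Matrix (Fin r) (Fin r) ℂ),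
    (Matrix.of fun p q : Fin n × Fin r =>
      ker H (z p.1) (z q.1) *
        ((1 : Matrix (Fin r) (Fin r) ℂ) - W p.1 * (W q.1).conjTranspose) p.2 q.2).PosSemidef →
    ∃ Φ : Matrix (Fin r) (Fin r) (Mult H), ‖matrixMulOp Φ‖ ≤ 1 ∧
      ∀ (i : Fin n) (a b : Fin r), (Φ a b : X → ℂ) (z i) = W i a b

/-- The functions on `X` belonging to `H`. -/
def functions : Set (X → ℂ) := Set.range fun f : H => ⇑f

/-- The Smirnov class `N⁺(H)`: quotients `φ / ψ` of multipliers with `ψ` cyclic. -/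
def Smirnov : Set (X → ℂ) :=
  {f | ∃ φ ψ : Mult H, IsCyclic ψ ∧ f = (φ : X → ℂ) / (ψ : X → ℂ)}

/-- `Z` is a zero set for the class `S` if some function in `S` vanishes exactly on `Z`. -/
def IsZeroSet {X : Type*} (S : Set (X → ℂ)) (Z : Set X) : Prop :=
  ∃ f ∈ S, ∀ x, f x = 0 ↔ x ∈ Z

end CompletePick

end

/-! The substance is that every `f` in `H` has the zeros of some multiplier; the other inclusions
hold because `1 ∈ H` and cyclic multipliers vanish nowhere, and unions of zero sets come from
products of multipliers.

The Pick property enters only through two facts: `k` has no zeros (`ker_ne_zero`), and `1 - 1/k` is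
positive semidefinite (`posSemidef_one_sub_inv_ker`), hence a Gram kernel `⟪b x, b y⟫`. The second
is proved by induction on the number of points, with a change of base point as the engine
(`posSemidef_change_base`).

From `b` one gets a contractive row operator on `ℂ ⊕ (G ⊗ H)` (`exists_row_contraction`). For `‖f‖ =
1` it shows that `k(·, z) f ∈ H` and that `φ(z) = f(z) / ⟨f, k(·, z) f⟩`, with the inner product
linear in the first entry and never zero, makes `k(z, w) (1 - φ(z) conj φ(w))` positive
semidefinite. So `φ` is a multiplier with the zeros of `f`. -/

open scoped ComplexOrder InnerProductSpace ComplexConjugate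

namespace CompletePick

/-! ### Positive semidefinite matrices as Gram matrices. -/

section Gram

variable {X : Type*} {E F : Type*} [NormedAddCommGroup E] [InnerProductSpace ℂ E]
  [NormedAddCommGroup F] [InnerProductSpace ℂ F]

theorem posSemidef_congr {M N : Matrix X X ℂ} (hM : M.PosSemidef) (h : ∀ i j, N i j = M i j) :
    N.PosSemidef := by
  rwa [Matrix.ext h]

theorem finsupp_sum_gram (v : X → E) (c : X →₀ ℂ) :
    (c.sum fun i a => c.sum fun j b => star a * Matrix.gram ℂ v i j * b) =
      ((‖Finsupp.linearCombination ℂ v c‖ ^ 2 : ℝ) : ℂ) := by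
  rw [Complex.ofReal_pow, ← Complex.coe_algebraMap, ← inner_self_eq_norm_sq_to_K (𝕜 := ℂ)]
  simp only [Finsupp.linearCombination_apply, Finsupp.sum, sum_inner, inner_sum, inner_smul_left,
    inner_smul_right, Matrix.gram_apply, Finset.mul_sum]
  rw [Finset.sum_comm]
  refine Finset.sum_congr rfl fun i _ => Finset.sum_congr rfl fun j _ => ?_
  simp only [Complex.star_def]
  ring

/-- A difference of Gram matrices is positive semidefinite iff `v i ↦ u i` is contractive. -/
theorem posSemidef_gram_sub_gram_iff (v : X → E) (u : X → F) :
    (Matrix.gram ℂ v - Matrix.gram ℂ u).PosSemidef ↔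
      ∀ c : X →₀ ℂ, ‖Finsupp.linearCombination ℂ u c‖ ≤ ‖Finsupp.linearCombination ℂ v c‖ := by
  have key (c : X →₀ ℂ) : (c.sum fun i a => c.sum fun j b =>
      star a * (Matrix.gram ℂ v - Matrix.gram ℂ u) i j * b) =
      ((‖Finsupp.linearCombination ℂ v c‖ ^ 2 - ‖Finsupp.linearCombination ℂ u c‖ ^ 2 : ℝ) : ℂ) := by
    rw [Complex.ofReal_sub, ← finsupp_sum_gram, ← finsupp_sum_gram]
    simp only [Finsupp.sum, Matrix.sub_apply, mul_sub, sub_mul, Finset.sum_sub_distrib]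
  constructor
  · intro h c
    have := h.2 c
    rw [key, Complex.zero_le_real, sub_nonneg] at this
    exact le_of_sq_le_sq this (norm_nonneg _)
  · intro h
    refine ⟨(Matrix.isHermitian_gram _ _).sub (Matrix.isHermitian_gram _ _), fun c => ?_⟩
    rw [key, Complex.zero_le_real, sub_nonneg]
    gcongr
    exact h c

theorem posSemidef_gram (v : X → E) : (Matrix.gram ℂ v).PosSemidef :=
  ⟨Matrix.isHermitian_gram _ _, fun c => by
    rw [finsupp_sum_gram, Complex.zero_le_real]; positivity⟩

theorem posSemidef_gram_sub_gram_map (v : X → E) (S : E →ₗ[ℂ] F) (hS : ∀ x, ‖S x‖ ≤ ‖x‖) :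
    (Matrix.gram ℂ v - Matrix.gram ℂ fun x => S (v x)).PosSemidef := by
  rw [posSemidef_gram_sub_gram_iff]
  intro c
  have : Finsupp.linearCombination ℂ (fun x => S (v x)) c =
      S (Finsupp.linearCombination ℂ v c) := by
    simp [Finsupp.linearCombination_apply, map_finsuppSum]
  rw [this]
  exact hS _

/-- A matrix is positive semidefinite as soon as all its finite sections are. -/
theorem posSemidef_of_fin_submatrix {M : Matrix X X ℂ}
    (h : ∀ (n : ℕ) (z : Fin n → X), (M.submatrix z z).PosSemidef) : M.PosSemidef := by
  classical
  refine ⟨?_, fun c => ?_⟩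
  · ext x y
    simpa using (h 2 ![x, y]).1.apply 0 1
  · have h1 := (h _ (fun i => (c.support.equivFin.symm i : X))).submatrix c.support.equivFin
    have h2 : (M.submatrix (↑) (↑) : Matrix c.support c.support ℂ).PosSemidef := by
      simpa [Matrix.submatrix_submatrix, Function.comp_def] using h1
    simpa [Finsupp.sum, ← Finset.sum_attach c.support, ← Finset.subtype_mem_eq_attach,
      ← Finsupp.subtypeDomain_apply, ← Finsupp.support_subtypeDomain] using h2.2 _

/-- A positive semidefinite matrix, indexed by any set, is the Gram matrix of vectors in a
Hilbert space. -/
theorem exists_gram_eq.{u} {X : Type u} {M : Matrix X X ℂ} (hM : M.PosSemidef) :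
    ∃ (G : Type u) (_ : NormedAddCommGroup G) (_ : InnerProductSpace ℂ G) (b : X → G),
      M = Matrix.gram ℂ b := by
  let K : Matrix X X (ℂ →L[ℂ] ℂ) := Matrix.of fun x y => M x y • (1 : ℂ →L[ℂ] ℂ)
  have hherm (x y : X) : conj (M x y) = M y x := hM.1.apply y x
  have hK : K.PosSemidef := by
    have htfae := (RKHS.posSemidef_tfae (K := K)).out 0 2
    refine htfae.mpr ⟨?_, fun v => ?_⟩
    · ext x y
      simp [K, Matrix.conjTranspose_apply, hherm]
    · have h := (Complex.le_def.mp (hM.2 v)).1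
      refine h.trans_eq (congrArg Complex.re ?_)
      refine Finsupp.sum_congr fun x _ => Finsupp.sum_congr fun y _ => ?_
      simp [K, hherm]
      ring
  have : Fact K.PosSemidef := ⟨hK⟩
  refine ⟨RKHS.OfKernel K, inferInstance, inferInstance,
    fun x => RKHS.kerFun (RKHS.OfKernel K) x 1, ?_⟩
  ext x y
  rw [Matrix.gram_apply, ← RKHS.kernel_inner, RKHS.OfKernel.kernel_ofKernel]
  simp [K, hherm]

end Gram

/-! ### Kernel functions and a positivity test for multipliers. -/

section Kernel

variable {X : Type*} (H : Type*) [NormedAddCommGroup H] [InnerProductSpace ℂ H] [RKHS ℂ H X ℂ]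
  [CompleteSpace H]

/-- The kernel function at `x`, as an element of `H`. -/
noncomputable def kerVec (x : X) : H := RKHS.kerFun H x 1

variable {H}

theorem inner_kerVec (x : X) (f : H) : ⟪kerVec H x, f⟫_ℂ = f x := by
  simp [kerVec]

theorem kerVec_apply (x y : X) : kerVec H y x = ker H x y := by
  rw [kerVec, RKHS.kerFun_apply, ker]

theorem inner_kerVec_kerVec (x y : X) : ⟪kerVec H x, kerVec H y⟫_ℂ = ker H x y := by
  rw [inner_kerVec, kerVec_apply]

theorem conj_ker (x y : X) : conj (ker H x y) = ker H y x := by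
  rw [← inner_kerVec_kerVec, inner_conj_symm, inner_kerVec_kerVec]

theorem ker_self (x : X) : ker H x x = ((‖kerVec H x‖ ^ 2 : ℝ) : ℂ) := by
  rw [← inner_kerVec_kerVec, inner_self_eq_norm_sq_to_K]; simp

variable (H) in
theorem denseRange_linearCombination_kerVec :
    DenseRange (Finsupp.linearCombination ℂ (kerVec H : X → H)) := by
  have h := RKHS.kerFun_dense (𝕜 := ℂ) (V := ℂ) (X := X) H
  rw [DenseRange, ← LinearMap.coe_range, Finsupp.range_linearCombination,
    Submodule.dense_iff_topologicalClosure_eq_top, ← top_le_iff, ← h]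
  refine Submodule.topologicalClosure_mono (Submodule.span_le.mpr ?_)
  rintro _ ⟨x, v, rfl⟩
  have : RKHS.kerFun H x v = v • kerVec H x := by
    rw [kerVec, ← map_smul, smul_eq_mul, mul_one]
  rw [this]
  exact Submodule.smul_mem _ _ (Submodule.subset_span ⟨x, rfl⟩)

/-- Positivity makes `kerVec H x ↦ v x` contractive on finite combinations, which are dense in `H`,
so it extends by continuity. -/
theorem exists_clm_kerVec_eq {E : Type*} [NormedAddCommGroup E] [InnerProductSpace ℂ E]
    [CompleteSpace E] {v : X → E}
    (hv : (Matrix.gram ℂ (kerVec H : X → H) - Matrix.gram ℂ v).PosSemidef) :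
    ∃ T : H →L[ℂ] E, (∀ g, ‖T g‖ ≤ ‖g‖) ∧ ∀ x, T (kerVec H x) = v x := by
  rw [posSemidef_gram_sub_gram_iff] at hv
  have hd := denseRange_linearCombination_kerVec (X := X) H
  have hb : ∀ c, ‖Finsupp.linearCombination ℂ v c‖ ≤
      1 * ‖Finsupp.linearCombination ℂ (kerVec H) c‖ := by simpa using hv
  refine ⟨(Finsupp.linearCombination ℂ v).extendOfNorm (Finsupp.linearCombination ℂ (kerVec H)),
    fun g => ?_, fun x => ?_⟩
  · simpa using LinearMap.norm_extendOfNorm_apply_le hd 1 hb g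
  · simpa using LinearMap.extendOfNorm_eq hd ⟨1, hb⟩ (Finsupp.single x 1)

theorem adjoint_mulOp_kerVec (φ : Mult H) (x : X) :
    (mulOp φ).adjoint (kerVec H x) = conj ((φ : X → ℂ) x) • kerVec H x := by
  refine ext_inner_right ℂ fun g => ?_
  rw [ContinuousLinearMap.adjoint_inner_left, inner_kerVec, mulOp_apply, inner_smul_left,
    inner_kerVec, Complex.conj_conj]

/-- If `k(z,w) (1 - φ(z) conj φ(w))` is positive semidefinite then `φ` is a multiplier. -/
theorem mem_mult_of_posSemidef {φ : X → ℂ}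
    (h : (Matrix.of fun x y : X => ker H x y * (1 - φ x * conj (φ y))).PosSemidef) :
    φ ∈ Mult H := by
  have h' : (Matrix.gram ℂ (kerVec H : X → H) -
      Matrix.gram ℂ fun x : X => conj (φ x) • kerVec H x).PosSemidef := by
    convert h using 1
    ext x y
    simp only [Matrix.sub_apply, Matrix.gram_apply, Matrix.of_apply, inner_smul_left,
      inner_smul_right, inner_kerVec_kerVec, Complex.conj_conj]
    ring
  obtain ⟨T, -, hT⟩ := exists_clm_kerVec_eq h'
  intro f
  -- `T` scales each kernel function by `conj (φ x)`, so its adjoint is multiplication by `φ`.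
  refine ⟨T.adjoint f, funext fun x => ?_⟩
  rw [← inner_kerVec, ContinuousLinearMap.adjoint_inner_right, hT, inner_smul_left, inner_kerVec,
    Complex.conj_conj, Pi.mul_apply]

end Kernel

/-! ### From the complete Pick property to positivity of `1 - 1/k`. -/

section PickKernel

variable {X : Type*} {H : Type*} [NormedAddCommGroup H] [InnerProductSpace ℂ H] [RKHS ℂ H X ℂ]
  [CompleteSpace H]

/-- Each row of a contractive operator matrix is contractive, hence so is its adjoint column.
Testing on `F`, the image of `g` under that column, gives `‖F‖² ≤ ‖g‖ ‖F‖`. -/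
theorem sum_norm_sq_adjoint_mulOp_le {r : ℕ} {Φ : Matrix (Fin r) (Fin r) (Mult H)}
    (hΦ : ‖matrixMulOp Φ‖ ≤ 1) (a : Fin r) (g : H) :
    ∑ b, ‖(mulOp (Φ a b)).adjoint g‖ ^ 2 ≤ ‖g‖ ^ 2 := by
  let F : PiLp 2 (fun _ : Fin r => H) := WithLp.toLp 2 fun b => (mulOp (Φ a b)).adjoint g
  have hF : ‖F‖ ^ 2 = ∑ b, ‖(mulOp (Φ a b)).adjoint g‖ ^ 2 := PiLp.norm_sq_eq_of_L2 _ F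
  have h1 : ⟪g, matrixMulOp Φ F a⟫_ℂ = ((‖F‖ ^ 2 : ℝ) : ℂ) := by
    rw [matrixMulOp_apply, inner_sum, hF, Complex.ofReal_sum]
    refine Finset.sum_congr rfl fun b _ => ?_
    rw [← ContinuousLinearMap.adjoint_inner_left, inner_self_eq_norm_sq_to_K]
    simp
  have h2 : ‖F‖ ^ 2 ≤ ‖g‖ * ‖F‖ := by
    calc ‖F‖ ^ 2 = ‖⟪g, matrixMulOp Φ F a⟫_ℂ‖ := by
          rw [h1, Complex.norm_real, Real.norm_of_nonneg (by positivity)]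
      _ ≤ ‖g‖ * ‖matrixMulOp Φ F a‖ := norm_inner_le_norm _ _
      _ ≤ ‖g‖ * ‖F‖ := by
          gcongr
          exact (PiLp.norm_apply_le _ a).trans ((matrixMulOp Φ).le_of_opNorm_le_of_le hΦ le_rfl
            |>.trans_eq (one_mul _))
  rw [← hF]
  rcases (norm_nonneg F).eq_or_lt with h | h
  · rw [← h]; simp
  · gcongr
    nlinarith

/-- A contractive row of multipliers remains contractive on the orthogonal complement of a
kernel function. -/
theorem posSemidef_schur_complement_of_row {r : ℕ} {Φ : Matrix (Fin r) (Fin r) (Mult H)}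
    (hΦ : ‖matrixMulOp Φ‖ ≤ 1) (a : Fin r) {y : X} (hy : ker H y y ≠ 0) :
    (Matrix.of fun z w : X => (ker H z w - ker H z y * ker H y w / ker H y y) *
      (1 - ∑ b, (Φ a b : X → ℂ) z * conj ((Φ a b : X → ℂ) w))).PosSemidef := by
  let P : H →L[ℂ] H := (ℂ ∙ kerVec H y)ᗮ.starProjection
  have hPle (g : H) : ‖P g‖ ≤ ‖g‖ := Submodule.norm_starProjection_apply_le _ g
  have hP (g : H) : P g = g - (g y / ker H y y) • kerVec H y := by
    have h : ((‖kerVec H y‖ : ℂ) ^ 2) = ker H y y := by rw [ker_self]; simp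
    simp only [P, Submodule.starProjection_orthogonal_val, Submodule.starProjection_singleton]
    simp [h, inner_kerVec]
  have hPy : P (kerVec H y) = 0 := by
    rw [hP, kerVec_apply, div_self hy, one_smul, sub_self]
  have hPin (z w : X) : ⟪P (kerVec H z), P (kerVec H w)⟫_ℂ =
      ker H z w - ker H z y * ker H y w / ker H y y := by
    rw [hP, hP]
    simp only [inner_sub_left, inner_sub_right, inner_smul_left, inner_smul_right, kerVec_apply,
      inner_kerVec_kerVec, map_div₀, conj_ker]
    field_simp
    ring
  let S : H →ₗ[ℂ] PiLp 2 (fun _ : Fin r => H) :=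
    { toFun := fun g => WithLp.toLp 2 fun b => P ((mulOp (Φ a b)).adjoint g)
      map_add' := fun f g => by ext1 b; simp
      map_smul' := fun c g => by ext1 b; simp }
  have hS (g : H) : ‖S g‖ ≤ ‖g‖ := by
    refine le_of_sq_le_sq ?_ (norm_nonneg _)
    rw [PiLp.norm_sq_eq_of_L2]
    refine le_trans (Finset.sum_le_sum fun b _ => ?_) (sum_norm_sq_adjoint_mulOp_le hΦ a g)
    gcongr
    exact hPle _
  -- `P g` differs from `g` by a multiple of `kerVec H y`, an eigenvector of each adjoint that `P`
  -- kills. So the inner `P` only matters up to a term that the outer `P` removes.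
  have hSP (z : X) (b : Fin r) :
      S (P (kerVec H z)) b = conj ((Φ a b : X → ℂ) z) • P (kerVec H z) := by
    change P ((mulOp (Φ a b)).adjoint (P (kerVec H z))) = _
    conv_lhs => rw [hP (kerVec H z)]
    simp [adjoint_mulOp_kerVec, hPy]
  convert posSemidef_gram_sub_gram_map (fun z : X => P (kerVec H z)) S hS using 1
  ext z w
  simp only [Matrix.of_apply, Matrix.sub_apply, Matrix.gram_apply, hPin, PiLp.inner_apply, hSP,
    inner_smul_left, inner_smul_right, Complex.conj_conj, mul_sub, mul_one, Finset.mul_sum]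
  congr 1
  exact Finset.sum_congr rfl fun b _ => by ring

/-- Equality in Cauchy–Schwarz: the contraction `mulOp φ` must fix `kerVec H x`, and this identity
is evaluated at `y`. -/
theorem eq_one_of_apply_eq_one {φ : Mult H} (hφ : ∀ g, ‖mulOp φ g‖ ≤ ‖g‖) {x y : X}
    (hx : (φ : X → ℂ) x = 1) (hxy : ker H y x ≠ 0) : (φ : X → ℂ) y = 1 := by
  have h1 : mulOp φ (kerVec H x) = kerVec H x := by
    refine eq_of_norm_le_re_inner_eq_norm_sq (𝕜 := ℂ) (hφ _) ?_
    rw [← inner_conj_symm, inner_kerVec, mulOp_apply, hx, kerVec_apply, one_mul, ker_self,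
      Complex.conj_ofReal]
    exact Complex.ofReal_re _
  have h2 := congrArg (fun g : H => g y) h1
  simp only [mulOp_apply, kerVec_apply] at h2
  exact mul_right_cancel₀ hxy (h2.trans (one_mul _).symm)

theorem norm_mulOp_apply_le_of_one_by_one {Φ : Matrix (Fin 1) (Fin 1) (Mult H)}
    (hΦ : ‖matrixMulOp Φ‖ ≤ 1) (g : H) : ‖mulOp (Φ 0 0) g‖ ≤ ‖g‖ := by
  have h : (mulOp (Φ 0 0)).adjoint.opNorm ≤ 1 := by
    refine ContinuousLinearMap.opNorm_le_bound _ zero_le_one fun f => ?_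
    rw [one_mul]
    refine le_of_sq_le_sq ?_ (norm_nonneg _)
    simpa using sum_norm_sq_adjoint_mulOp_le hΦ 0 f
  refine (ContinuousLinearMap.le_of_opNorm_le _ (c := 1) ?_ g).trans_eq (one_mul _)
  rw [← LinearIsometryEquiv.norm_map ContinuousLinearMap.adjoint]
  exact h

/-- The kernel of a normalized complete Pick space has no zeros. -/
theorem ker_ne_zero (hnorm : IsNormalized H) (hpick : IsCompletePick H) (x y : X) :
    ker H x y ≠ 0 := by
  intro hxy
  have hyx : ker H y x = 0 := by rw [← conj_ker, hxy, map_zero]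
  obtain ⟨x₀, h₀⟩ := id hnorm
  have h₀' (z : X) : ker H x₀ z = 1 := by rw [← conj_ker, h₀, map_one]
  -- The Pick matrix is zero: on the diagonal because the targets are unimodular, off it because
  -- `k(x, y) = 0`. The interpolant would then be both `1` and `-1` at `x₀`.
  obtain ⟨Φ, hΦ, hv⟩ := hpick 1 2 ![x, y] ![1, -1] (by
    convert Matrix.PosSemidef.zero using 1
    ext ⟨i, a⟩ ⟨j, b⟩
    fin_cases i <;> fin_cases j <;> fin_cases a <;> fin_cases b <;> simp [hxy, hyx])
  have hle := norm_mulOp_apply_le_of_one_by_one hΦ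
  have h1 : (Φ 0 0 : X → ℂ) x₀ = 1 :=
    eq_one_of_apply_eq_one hle (x := x) (by simpa using hv 0 0 0) (by simp [h₀'])
  have h2 : ((-Φ 0 0 : Mult H) : X → ℂ) x₀ = 1 := by
    refine eq_one_of_apply_eq_one (x := y) (fun g => ?_) ?_ (by simp [h₀'])
    · have : mulOp (-Φ 0 0) g = -mulOp (Φ 0 0) g := by
        ext z
        simp [mulOp_apply]
      rw [this, norm_neg]
      exact hle g
    · simpa [neg_eq_iff_eq_neg] using hv 1 0 0
  have h3 : -(Φ 0 0 : X → ℂ) x₀ = 1 := h2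
  rw [h1] at h3
  norm_num at h3

/-- A matrix whose first row and column vanish is positive semidefinite if the rest is. -/
theorem posSemidef_of_tail {n : ℕ} {M : Matrix (Fin (n + 1)) (Fin (n + 1)) ℂ}
    (hrow : ∀ j, M 0 j = 0) (hcol : ∀ i, M i 0 = 0)
    (h : (M.submatrix Fin.succ Fin.succ).PosSemidef) : M.PosSemidef := by
  refine .of_dotProduct_mulVec_nonneg ?_ fun c => ?_
  · ext i j
    refine Fin.cases ?_ (fun i => ?_) i
    · simp [hrow, hcol]
    · refine Fin.cases ?_ (fun j => ?_) j
      · simp [hrow, hcol]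
      · exact h.1.apply i j
  · convert h.dotProduct_mulVec_nonneg (fun i => c i.succ) using 1
    simp [dotProduct, Matrix.mulVec, Fin.sum_univ_succ, hrow, hcol]

theorem posSemidef_kerMatrix (H : Type*) [NormedAddCommGroup H] [InnerProductSpace ℂ H]
    [RKHS ℂ H X ℂ] [CompleteSpace H] : (Matrix.of (ker H : X → X → ℂ)).PosSemidef := by
  convert posSemidef_gram (kerVec H : X → H) using 1
  ext x y
  rw [Matrix.of_apply, Matrix.gram_apply, inner_kerVec_kerVec]

theorem posSemidef_rescale {ι : Type*} {M : Matrix ι ι ℂ} (hM : M.PosSemidef) (a : ι → ℂ) :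
    (Matrix.of fun i j => a i * M i j * conj (a j)).PosSemidef := by
  refine posSemidef_congr ((posSemidef_gram fun i => conj (a i)).hadamard hM) fun i j => ?_
  simp only [Matrix.of_apply, Matrix.hadamard_apply, Matrix.gram_apply, RCLike.inner_apply,
    Complex.conj_conj]
  ring

/-- A finite section of the complete Pick property: if `1 - k(z,u) k(u,w) / (k(z,w) k(u,u))` is
positive semidefinite on a finite set containing `u`, the same holds with any other base point. -/
theorem posSemidef_change_base (hnorm : IsNormalized H) (hpick : IsCompletePick H) {n : ℕ}
    (z : Fin (n + 1) → X) (u y : X)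
    (h : (Matrix.of fun i j => 1 - ker H (z i) u * ker H u (z j) /
      (ker H (z i) (z j) * ker H u u)).PosSemidef) :
    (Matrix.of fun i j => 1 - ker H (z i) y * ker H y (z j) /
      (ker H (z i) (z j) * ker H y y)).PosSemidef := by
  have hk := ker_ne_zero hnorm hpick
  obtain ⟨A, hA⟩ : ∃ A : Matrix (Fin (n + 1)) (Fin (n + 1)) ℂ, _ = A * A.conjTranspose := by
    open scoped MatrixOrder in
    exact CStarAlgebra.nonneg_iff_eq_mul_star_self.mp h.nonneg
  have hA' (i j) : ∑ b, A i b * conj (A j b) = 1 - ker H (z i) u * ker H u (z j) /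
      (ker H (z i) (z j) * ker H u u) := by
    have := congrFun (congrFun hA i) j
    rw [Matrix.of_apply] at this
    rw [this, Matrix.mul_apply]
    rfl
  -- The rows of `A` are placed in row `0` of square matrices. The Pick matrix then splits into the
  -- rank-one kernel `k(z, u) k(u, w) / k(u, u)` in the corner and copies of `k` on the remaining
  -- diagonal.
  let W : Fin (n + 1) → Matrix (Fin (n + 1)) (Fin (n + 1)) ℂ :=
    fun i => Matrix.of fun a b => if a = 0 then A i b else 0
  have hR : (Matrix.of fun i j => ker H (z i) u * ker H u (z j) / ker H u u).PosSemidef := by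
    have h1 : (Matrix.of fun i j : Fin (n + 1) => (ker H u u)⁻¹).PosSemidef := by
      convert posSemidef_gram
        (fun _ : Fin (n + 1) => ((‖kerVec H u‖⁻¹ : ℝ) : ℂ)) using 1
      ext i j
      simp [Matrix.gram_apply, ker_self, sq]
    convert posSemidef_rescale h1 (fun i => ker H (z i) u) using 1
    ext i j
    simp only [Matrix.of_apply, conj_ker]
    ring
  obtain ⟨Φ, hΦ, hv⟩ := hpick (n + 1) (n + 1) z W (by
    have h1 := ((posSemidef_kerMatrix H).submatrix z).kronecker
      (Matrix.PosSemidef.diagonal (d := fun a : Fin (n + 1) => if a = 0 then (0 : ℂ) else 1)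
        (fun a => by dsimp; split_ifs <;> simp))
    have h2 := hR.kronecker
      (Matrix.PosSemidef.diagonal (d := fun a : Fin (n + 1) => if a = 0 then (1 : ℂ) else 0)
        (fun a => by dsimp; split_ifs <;> simp))
    refine posSemidef_congr (h1.add h2) ?_
    rintro ⟨i, a⟩ ⟨j, b⟩
    have hWW : (W i * (W j).conjTranspose) a b = if a = 0 ∧ b = 0 then
        1 - ker H (z i) u * ker H u (z j) / (ker H (z i) (z j) * ker H u u) else 0 := by
      rw [← hA', Matrix.mul_apply]
      by_cases ha : a = 0 <;> by_cases hb : b = 0 <;> simp [W, ha, hb]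
    simp only [Matrix.of_apply, Matrix.add_apply, Matrix.kronecker_apply, Matrix.submatrix_apply,
      Matrix.sub_apply, hWW, Matrix.diagonal_apply, Matrix.one_apply]
    have := hk (z i) (z j)
    have := hk u u
    by_cases hab : a = b
    · subst hab
      by_cases ha : a = 0
      · simp [ha]
        field_simp
      · simp [ha]
    · have : ¬ (a = 0 ∧ b = 0) := fun h => hab (h.1.trans h.2.symm)
      simp [hab, this])
  have h3 := (posSemidef_schur_complement_of_row hΦ 0 (hk y y)).submatrix z
  -- At the nodes, `1 - ΦΦ*` is a rank-one kernel divided by `k`. The rescaling cancels the rank-one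
  -- factor, leaving the Schur complement at `y` divided by `k`.
  convert posSemidef_rescale h3 (fun i => (ker H (z i) u)⁻¹ * (‖kerVec H u‖ : ℂ)) using 1
  ext i j
  have hs : ∑ b, (Φ 0 b : X → ℂ) (z i) * conj ((Φ 0 b : X → ℂ) (z j)) =
      1 - ker H (z i) u * ker H u (z j) / (ker H (z i) (z j) * ker H u u) := by
    rw [← hA']
    refine Finset.sum_congr rfl fun b _ => ?_
    rw [hv, hv]
    simp [W]
  simp only [Matrix.of_apply, Matrix.submatrix_apply, hs, map_mul, map_inv₀, conj_ker,
    Complex.conj_ofReal]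
  have hu : ker H u u = (‖kerVec H u‖ : ℂ) * ‖kerVec H u‖ := by rw [ker_self]; push_cast; ring
  have hu' : (‖kerVec H u‖ : ℂ) ≠ 0 := fun h => hk u u (by rw [hu, h, zero_mul])
  rw [hu]
  have := hk (z i) (z j)
  have := hk (z i) u
  have := hk u (z j)
  have := hk y y
  field_simp
  ring

/-- Induction works because the base point is arbitrary. With base `z 0` the first row and column
vanish, so only `n` points remain; the base is then moved to `y`. -/
theorem posSemidef_fin_one_sub (hnorm : IsNormalized H) (hpick : IsCompletePick H) (n : ℕ) :
    ∀ (z : Fin n → X) (y : X), (Matrix.of fun i j => 1 - ker H (z i) y * ker H y (z j) /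
      (ker H (z i) (z j) * ker H y y)).PosSemidef := by
  have hk := ker_ne_zero hnorm hpick
  induction n with
  | zero =>
    intro z y
    convert Matrix.PosSemidef.zero using 1
    ext i
    exact i.elim0
  | succ n ih =>
    intro z y
    refine posSemidef_change_base hnorm hpick z (z 0) y (posSemidef_of_tail ?_ ?_ ?_)
    · intro j
      rw [Matrix.of_apply, mul_comm, div_self (mul_ne_zero (hk _ _) (hk _ _)), sub_self]
    · intro i
      rw [Matrix.of_apply, div_self (mul_ne_zero (hk _ _) (hk _ _)), sub_self]
    · exact ih (fun i => z i.succ) (z 0)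

/-- In a normalized complete Pick space `1 - 1 / k` is positive semidefinite. -/
theorem posSemidef_one_sub_inv_ker (hnorm : IsNormalized H) (hpick : IsCompletePick H) :
    (Matrix.of fun x y : X => 1 - (ker H x y)⁻¹).PosSemidef := by
  obtain ⟨x₀, h₀⟩ := id hnorm
  have h₀' (z : X) : ker H x₀ z = 1 := by rw [← conj_ker, h₀, map_one]
  refine posSemidef_of_fin_submatrix fun n z => ?_
  convert posSemidef_fin_one_sub hnorm hpick n z x₀ using 1
  ext i j
  simp [h₀, h₀']

end PickKernel

/-! ### Replacing a function in `H` by a multiplier with the same zeros. -/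

section Factorization

open scoped TensorProduct

theorem inner_prod_tmul {G H : Type*} [NormedAddCommGroup G] [InnerProductSpace ℂ G]
    [NormedAddCommGroup H] [InnerProductSpace ℂ H]
    (c d : ℂ) (b b' : G) (g g' : H) :
    ⟪(WithLp.toLp 2 (c, ((b ⊗ₜ[ℂ] g : G ⊗[ℂ] H) : UniformSpace.Completion (G ⊗[ℂ] H))) :
        WithLp 2 (ℂ × UniformSpace.Completion (G ⊗[ℂ] H))),
      WithLp.toLp 2 (d, ((b' ⊗ₜ[ℂ] g' : G ⊗[ℂ] H) : UniformSpace.Completion (G ⊗[ℂ] H)))⟫_ℂ =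
      conj c * d + ⟪b, b'⟫_ℂ * ⟪g, g'⟫_ℂ := by
  rw [WithLp.prod_inner_apply]
  simp [UniformSpace.Completion.inner_coe, mul_comm]

variable {X : Type*} {H : Type*} [NormedAddCommGroup H] [InnerProductSpace ℂ H] [RKHS ℂ H X ℂ]
  [CompleteSpace H]

/-- For a normalized kernel with `1 - 1/k = ⟪b, b⟫`, the row operator with entries `1` and `b`
is contractive. It is given here through its values `c, b_z ⊗ g ↦ c + (1 - 1/k(·,z)) g`. -/
theorem exists_row_contraction {G : Type*} [NormedAddCommGroup G] [InnerProductSpace ℂ G]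
    (hk : ∀ x y : X, ker H x y ≠ 0) {b : X → G}
    (hb : ∀ x y, 1 - (ker H x y)⁻¹ = ⟪b x, b y⟫_ℂ) :
    ∃ V : WithLp 2 (ℂ × UniformSpace.Completion (G ⊗[ℂ] H)) →L[ℂ] H,
      (∀ ξ, ‖V ξ‖ ≤ ‖ξ‖) ∧ ∀ (c : ℂ) (z : X) (g : H) (x : X),
        V (WithLp.toLp 2 (c, ((b z ⊗ₜ[ℂ] g : G ⊗[ℂ] H) : UniformSpace.Completion (G ⊗[ℂ] H)))) x =
          c + (1 - (ker H x z)⁻¹) * g x := by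
  let v (z : X) : WithLp 2 (ℂ × UniformSpace.Completion (G ⊗[ℂ] H)) :=
    WithLp.toLp 2 (1, ((b z ⊗ₜ[ℂ] kerVec H z : G ⊗[ℂ] H) : UniformSpace.Completion (G ⊗[ℂ] H)))
  -- The two Gram matrices coincide, since `1 + (1 - 1/k) k = k`; `V` is the adjoint of the
  -- resulting isometry.
  have hv : (Matrix.gram ℂ (kerVec H : X → H) - Matrix.gram ℂ v).PosSemidef := by
    refine posSemidef_congr Matrix.PosSemidef.zero fun x y => ?_
    have := hk x y
    rw [Matrix.sub_apply, Matrix.gram_apply, Matrix.gram_apply, inner_prod_tmul, ← hb,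
      inner_kerVec_kerVec, Matrix.zero_apply, map_one]
    field_simp
    ring
  obtain ⟨T, hT, hTv⟩ := exists_clm_kerVec_eq hv
  refine ⟨T.adjoint, fun ξ => ?_, fun c z g x => ?_⟩
  · refine (ContinuousLinearMap.le_of_opNorm_le _ (c := 1) ?_ ξ).trans_eq (one_mul _)
    rw [LinearIsometryEquiv.norm_map]
    exact ContinuousLinearMap.opNorm_le_bound _ zero_le_one fun g => by simpa using hT g
  · rw [← inner_kerVec, ContinuousLinearMap.adjoint_inner_right, hTv, inner_prod_tmul, ← hb,
      inner_kerVec, map_one, one_mul]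

/-- On the diagonal, `‖b z‖² = 1 - 1/k(z, z)`. Strictness makes `1 - A` invertible for
multiplication `A` by `1 - 1/k(·, z)`. -/
theorem norm_lt_one_of_inner_eq {G : Type*} [NormedAddCommGroup G] [InnerProductSpace ℂ G]
    (hk : ∀ x y : X, ker H x y ≠ 0) {b : X → G}
    (hb : ∀ x y, 1 - (ker H x y)⁻¹ = ⟪b x, b y⟫_ℂ) (z : X) : ‖b z‖ < 1 := by
  have h : 1 - (‖kerVec H z‖ ^ 2)⁻¹ = ‖b z‖ ^ 2 := by
    apply Complex.ofReal_injective
    rw [Complex.ofReal_sub, Complex.ofReal_inv, ← ker_self, Complex.ofReal_one, hb,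
      inner_self_eq_norm_sq_to_K]
    simp
  have hz : 0 < ‖kerVec H z‖ ^ 2 := by
    have := hk z z
    rw [ker_self, Complex.ofReal_ne_zero] at this
    positivity
  have := inv_pos.mpr hz
  nlinarith [norm_nonneg (b z)]

/-- Every unit vector of a normalized complete Pick space has the same zeros as some
multiplier. -/
theorem exists_mult_zeros_eq_of_norm_eq_one (hnorm : IsNormalized H) (hpick : IsCompletePick H)
    {f : H} (hf : ‖f‖ = 1) :
    ∃ φ ∈ Mult H, ∀ x : X, φ x = 0 ↔ f x = 0 := by
  have hk := ker_ne_zero hnorm hpick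
  obtain ⟨G, _, _, b, hgram⟩ := exists_gram_eq (posSemidef_one_sub_inv_ker hnorm hpick)
  have hb (x y : X) : 1 - (ker H x y)⁻¹ = ⟪b x, b y⟫_ℂ := congrFun (congrFun hgram x) y
  obtain ⟨V, hV, hVapp⟩ := exists_row_contraction hk hb
  let ι (c : ℂ) (z : X) (g : H) : WithLp 2 (ℂ × UniformSpace.Completion (G ⊗[ℂ] H)) :=
    WithLp.toLp 2 (c, ((b z ⊗ₜ[ℂ] g : G ⊗[ℂ] H) : UniformSpace.Completion (G ⊗[ℂ] H)))
  have hι (z : X) (g : H) : ‖ι 0 z g‖ ≤ ‖b z‖ * ‖g‖ := by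
    refine le_of_sq_le_sq (le_of_eq ?_) (by positivity)
    have h := inner_prod_tmul 0 0 (b z) (b z) g g
    rw [inner_self_eq_norm_sq_to_K, inner_self_eq_norm_sq_to_K, inner_self_eq_norm_sq_to_K,
      mul_zero, zero_add, ← mul_pow] at h
    exact_mod_cast h
  have hA (z : X) : ∃ A : H →L[ℂ] H, (∀ g, ‖A g‖ ≤ ‖b z‖ * ‖g‖) ∧
      ∀ g x, A g x = (1 - (ker H x z)⁻¹) * g x := by
    refine ⟨LinearMap.mkContinuous
      { toFun := fun g => V (ι 0 z g)
        map_add' := fun g h => by ext x; simp [ι, hVapp, mul_add]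
        map_smul' := fun c g => by
          ext x
          simp only [ι, hVapp, RKHS.coe_smul, Pi.smul_apply, smul_eq_mul, RingHom.id_apply]
          ring } ‖b z‖
      (fun g => (hV _).trans (hι z g)), fun g => (hV _).trans (hι z g), fun g x => ?_⟩
    exact (hVapp 0 z g x).trans (zero_add _)
  -- Since `1 - A` divides by `k(·, z)`, the element `g = (1 - A)⁻¹ f` is `k(·, z) f`.
  have hg (z : X) : ∃ g : H, (∀ x, g x = ker H x z * f x) ∧ ⟪f, g⟫_ℂ ≠ 0 := by
    obtain ⟨A, hAn, hAapp⟩ := hA z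
    have hlt : ‖A‖ < 1 := (A.opNorm_le_bound (norm_nonneg _) hAn).trans_lt
      (norm_lt_one_of_inner_eq hk hb z)
    obtain ⟨u, hu⟩ := isUnit_one_sub_of_norm_lt_one hlt
    let g : H := (↑u⁻¹ : H →L[ℂ] H) f
    have hgf : g - A g = f := by
      have : (u * ↑u⁻¹ : H →L[ℂ] H) f = f := by rw [Units.mul_inv]; rfl
      rw [hu] at this
      exact this
    refine ⟨g, fun x => ?_, fun h0 => ?_⟩
    · have h := congrArg (fun h : H => h x) hgf
      simp only [RKHS.coe_sub, Pi.sub_apply, hAapp] at h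
      have := hk x z
      rw [← h]
      field_simp
      ring
    -- If `f ⊥ g`, Pythagoras gives `‖A g‖² = ‖g‖² + 1`, contradicting contractivity of `A`.
    · have h1 : A g = g - f := by rw [← hgf]; abel
      have h2 : ‖g - f‖ ^ 2 = ‖g‖ ^ 2 + 1 := by
        rw [norm_sub_sq (𝕜 := ℂ), ← inner_conj_symm, h0, hf]
        simp
      have h3 : ‖A g‖ ≤ ‖g‖ :=
        (hAn g).trans (mul_le_of_le_one_left (norm_nonneg _) (norm_lt_one_of_inner_eq hk hb z).le)
      rw [h1] at h3
      nlinarith [norm_nonneg (g - f), norm_nonneg g]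
  choose g hgapp hgne using hg
  let φ (z : X) : ℂ := f z / conj ⟪f, g z⟫_ℂ
  refine ⟨φ, mem_mult_of_posSemidef ?_, fun x => ?_⟩
  -- `φ z` is chosen so that `l z ⊥ f`. This removes the cross terms from the Gram matrix of `V (ι 1
  -- z (l z)) = l z + conj (φ z) • f`.
  · let l (z : X) : H := kerVec H z - conj (φ z) • g z
    have hfl (z : X) : ⟪f, l z⟫_ℂ = 0 := by
      have := hgne z
      simp only [l, φ, inner_sub_right, inner_smul_right, map_div₀, Complex.conj_conj]
      rw [← inner_conj_symm, inner_kerVec]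
      field_simp
      ring
    have hlf (z : X) : ⟪l z, f⟫_ℂ = 0 := by rw [← inner_conj_symm, hfl, map_zero]
    have hVl (z : X) : V (ι 1 z (l z)) = l z + conj (φ z) • f := by
      ext x
      have := hk x z
      simp only [ι, hVapp, l, RKHS.coe_add, RKHS.coe_sub, RKHS.coe_smul, Pi.add_apply,
        Pi.sub_apply, Pi.smul_apply, smul_eq_mul, kerVec_apply, hgapp]
      field_simp
      ring
    have hpos := posSemidef_gram_sub_gram_map (fun z : X => ι 1 z (l z)) V.toLinearMap hV
    have hprod := ((posSemidef_kerMatrix (X := X) H).hadamard hpos).add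
      (posSemidef_gram l)
    -- With `L = ⟪l x, l y⟫`, the identity is `k (1 + (1 - 1/k) L - L - φ(x) conj φ(y)) + L = k (1 -
    -- φ(x) conj φ(y))`.
    refine posSemidef_congr hprod fun x y => ?_
    have hff : ⟪f, f⟫_ℂ = 1 := by rw [inner_self_eq_norm_sq_to_K, hf]; simp
    have h1 : ⟪ι 1 x (l x), ι 1 y (l y)⟫_ℂ = 1 + (1 - (ker H x y)⁻¹) * ⟪l x, l y⟫_ℂ := by
      rw [inner_prod_tmul, hb, map_one, one_mul]
    have h2 : ⟪V (ι 1 x (l x)), V (ι 1 y (l y))⟫_ℂ = ⟪l x, l y⟫_ℂ + φ x * conj (φ y) := by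
      simp only [hVl, inner_add_left, inner_add_right, inner_smul_left, inner_smul_right, hfl, hlf,
        hff, Complex.conj_conj]
      ring
    simp only [Matrix.of_apply, Matrix.add_apply, Matrix.hadamard_apply, Matrix.sub_apply,
      Matrix.gram_apply, ContinuousLinearMap.coe_coe, h1, h2]
    have := hk x y
    field_simp
    ring
  · exact div_eq_zero_iff.trans (or_iff_left ((map_ne_zero _).mpr (hgne x)))

theorem exists_mult_zeros_eq (hnorm : IsNormalized H) (hpick : IsCompletePick H) (f : H) :
    ∃ φ ∈ Mult H, ∀ x : X, φ x = 0 ↔ f x = 0 := by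
  by_cases hf : f = 0
  · exact ⟨0, zero_mem _, by simp [hf]⟩
  · have hn : (‖f‖ : ℂ) ≠ 0 := by simpa using hf
    obtain ⟨φ, hφ, h⟩ := exists_mult_zeros_eq_of_norm_eq_one hnorm hpick
      (f := (‖f‖ : ℂ)⁻¹ • f) (norm_smul_inv_norm hf)
    exact ⟨φ, hφ, fun x => by rw [h x]; simp [hf]⟩

end Factorization

/-! ### Comparison of the three classes of zero sets. -/

section ZeroSets

variable {X : Type*} {H : Type*} [NormedAddCommGroup H] [InnerProductSpace ℂ H] [RKHS ℂ H X ℂ]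
  [CompleteSpace H]

theorem exists_coe_eq_one (hnorm : IsNormalized H) : ∃ e : H, (⇑e : X → ℂ) = 1 := by
  obtain ⟨x₀, h₀⟩ := hnorm
  exact ⟨kerVec H x₀, funext fun x => by rw [kerVec_apply, h₀, Pi.one_apply]⟩

/-- A zero of `ψ` at `x` would confine the range of `mulOp ψ` to the closed subspace of functions
vanishing at `x`, which misses the constant `1`. -/
theorem IsCyclic.apply_ne_zero (hnorm : IsNormalized H) {ψ : Mult H} (hψ : IsCyclic ψ) (x : X) :
    (ψ : X → ℂ) x ≠ 0 := by
  intro h0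
  obtain ⟨e, he⟩ := exists_coe_eq_one hnorm
  have hclosed : IsClosed {g : H | g x = 0} :=
    isClosed_eq (RKHS.continuous_eval (𝕜 := ℂ) x) continuous_const
  have h : e ∈ {g : H | g x = 0} := by
    refine hclosed.closure_subset_iff.mpr ?_ (hψ e)
    rintro _ ⟨g, rfl⟩
    simp [mulOp_apply, h0]
  simp [he] at h

theorem isCyclic_one : IsCyclic (1 : Mult H) := by
  refine Function.Surjective.denseRange fun g => ⟨g, ?_⟩
  ext x
  simp [mulOp_apply]

theorem isZeroSet_functions_iff (hnorm : IsNormalized H) (hpick : IsCompletePick H) (Z : Set X) :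
    IsZeroSet (functions H) Z ↔ IsZeroSet (Mult H : Set (X → ℂ)) Z := by
  constructor
  · rintro ⟨_, ⟨f, rfl⟩, hf⟩
    obtain ⟨φ, hφ, h⟩ := exists_mult_zeros_eq hnorm hpick f
    exact ⟨φ, hφ, fun x => (h x).trans (hf x)⟩
  · rintro ⟨φ, hφ, h⟩
    obtain ⟨e, he⟩ := exists_coe_eq_one hnorm
    obtain ⟨g, hg⟩ := hφ e
    exact ⟨φ, ⟨g, by simp [hg, he]⟩, h⟩

theorem isZeroSet_mult_iff (hnorm : IsNormalized H) (Z : Set X) :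
    IsZeroSet (Mult H : Set (X → ℂ)) Z ↔ IsZeroSet (Smirnov H) Z := by
  constructor
  · rintro ⟨φ, hφ, h⟩
    exact ⟨φ, ⟨⟨φ, hφ⟩, 1, isCyclic_one, by simp⟩, h⟩
  · rintro ⟨_, ⟨φ, ψ, hψ, rfl⟩, h⟩
    refine ⟨φ, φ.2, fun x => ?_⟩
    rw [← h x]
    simp [hψ.apply_ne_zero hnorm x]

end ZeroSets

end CompletePick

theorem corollary1p2 {X : Type*} (H : Type*) [NormedAddCommGroup H] [InnerProductSpace ℂ H]
    [CompleteSpace H] [RKHS ℂ H X ℂ]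
    (hnorm : CompletePick.IsNormalized H) (hpick : CompletePick.IsCompletePick H) :
    (∀ Z : Set X,
      (CompletePick.IsZeroSet (CompletePick.functions H) Z ↔
        CompletePick.IsZeroSet (CompletePick.Mult H : Set (X → ℂ)) Z) ∧
      (CompletePick.IsZeroSet (CompletePick.Mult H : Set (X → ℂ)) Z ↔
        CompletePick.IsZeroSet (CompletePick.Smirnov H) Z)) ∧
    ∀ Z₁ Z₂ : Set X,
      CompletePick.IsZeroSet (CompletePick.functions H) Z₁ →
      CompletePick.IsZeroSet (CompletePick.functions H) Z₂ →
      CompletePick.IsZeroSet (CompletePick.functions H) (Z₁ ∪ Z₂) := by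
  refine ⟨fun Z => ⟨CompletePick.isZeroSet_functions_iff hnorm hpick Z,
    CompletePick.isZeroSet_mult_iff hnorm Z⟩, fun Z₁ Z₂ h₁ h₂ => ?_⟩
  rw [CompletePick.isZeroSet_functions_iff hnorm hpick] at h₁ h₂ ⊢
  obtain ⟨φ₁, hφ₁, h₁⟩ := h₁
  obtain ⟨φ₂, hφ₂, h₂⟩ := h₂
  exact ⟨φ₁ * φ₂, mul_mem hφ₁ hφ₂, fun x => by
    rw [Pi.mul_apply, mul_eq_zero, h₁ x, h₂ x, Set.mem_union]⟩
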